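/- Call a polynomial $P\in\mathbb R[x_1,\dots,x_n]$ real stable if $P=0$ or $P(z_1,\dots,z_n)\neq 0$ whenever $\operatorname{Im} z_i>0$ for all $i$. Lorentzian polynomials are defined recursively: a homogeneous polynomial of degree at most $2$ is Lorentzian if it is real stable and has nonnegative coefficients; a homogeneous polynomial of degree at least $3$ is Lorentzian if its support $J\subseteq\mathbb Z_{\ge0}^n$ is M-convex and each first partial derivative $\partial P/\partial x_i$ is Lorentzian (the zero polynomial counts as Lorentzian of every degree). Here $J$ is M-convex if for all $\alpha,\beta\in J$ and every $i$ with $\alpha_i>\beta_i$ there is $j$ with $\alpha_j<\beta_j$ such that $\alpha-e_i+e_j\in J$ and $\beta-e_j+e_i\in J$. For $\alpha\in\mathbb R_{\ge 0}^n$ and $P$ with nonnegative coefficients put $$\mathrm{cap}_{\alpha}(P)=\inf_{x_1,\dots,x_n>0}\frac{P(x_1,\dots,x_n)}{x_1^{\alpha_1}\cdots x_n^{\alpha_n}}.$$ **Corollary.** Let $P(x_1,\dots,x_n)$ be a Lorentzian polynomial of degree $d$, let $r=(r_1,\dots,r_n)\in\mathbb Z_{\ge0}^n$, and let $a_r$ be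 the coefficient of $\prod_{i=1}^n x_i^{r_i}$ in $P$. Then $$a_{r}\;\geq\;\left(\prod_{i=1}^n\binom{d}{r_i}\left(\frac{r_i}{d}\right)^{r_i}\left(\frac{d-r_i}{d}\right)^{d-r_i}\right)\mathrm{cap}_{r}(P),$$ where $0^0=1$, a factor with $r_i>d$ is read as $0$, and for $d=0$ a factor with $r_i=0$ is read as $1$. -/

import Mathlib

/-- A polynomial with real coefficients is real stable if it has no zero at a point all of whose
coordinates have positive imaginary part. As is usual, the zero polynomial is counted as stable. -/
def IsRealStable {σ : Type*} (P : MvPolynomial σ ℝ) : Prop :=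
  P = 0 ∨ ∀ z : σ → ℂ, (∀ i, 0 < (z i).im) → MvPolynomial.aeval z P ≠ 0

/-- M-convexity of a set of exponent vectors (simultaneous exchange property): if `α, β ∈ J` and
`α i > β i`, then there is `j` with `α j < β j` such that both `α - e i + e j` and
`β - e j + e i` lie in `J`. The subtractions never truncate, since `α i` and `β j` are positive. -/
def IsMConvex {σ : Type*} (J : Set (σ →₀ ℕ)) : Prop :=
  ∀ α ∈ J, ∀ β ∈ J, ∀ i, β i < α i →
    ∃ j, α j < β j ∧
      α - Finsupp.single i 1 + Finsupp.single j 1 ∈ J ∧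
      β - Finsupp.single j 1 + Finsupp.single i 1 ∈ J

/-- `IsLorentzian d P`: the polynomial `P` is homogeneous of degree `d` and Lorentzian.
In degree at most two this means real stable with nonnegative coefficients; in degree at least
three it means that the support is M-convex and that all first partial derivatives are Lorentzian.
The zero polynomial is Lorentzian of every degree, since it occurs as a derivative. -/
def IsLorentzian {σ : Type*} : ℕ → MvPolynomial σ ℝ → Prop
  | d + 3, P => P.IsHomogeneous (d + 3) ∧ IsMConvex (P.support : Set (σ →₀ ℕ)) ∧
      ∀ i, IsLorentzian (d + 2) (MvPolynomial.pderiv i P)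
  | d, P => P.IsHomogeneous d ∧ (∀ m, 0 ≤ P.coeff m) ∧ IsRealStable P

/-- The capacity `inf_{x > 0} P(x) / ∏ x_i ^ α_i`. For polynomials with nonnegative coefficients
the quotients are nonnegative, so the infimum is a genuine one. -/
noncomputable def capacity {σ : Type*} [Fintype σ] (α : σ → ℝ) (P : MvPolynomial σ ℝ) : ℝ :=
  ⨅ x : {x : σ → ℝ // ∀ i, 0 < x i}, MvPolynomial.eval x.1 P / ∏ i, x.1 i ^ α i

/-! Variables are eliminated one at a time. For `P` Lorentzian of degree `e ≤ d`, `x > 0` and a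
variable `i`, write `P(x + t eᵢ) = ∑ q k / k! * t ^ k` with `q k` the `k`-th derivative at `x`. The
sequence `q k * (d - k)!` is log-concave, so it lies below the geometric sequence through two
consecutive terms; thus the polynomial in `t` is at most a multiple of `(1 + s t) ^ d` with the same
`m`-th coefficient. A lower bound `c t ^ m` at the optimal `t` gives `q m / m! ≥ binomialMode d m *
c`. This is again a lower bound for a Lorentzian polynomial, the `m`-th derivative, and the argument
repeats with the same `d`. The initial bound is the definition of capacity.

Log-concavity is the reverse Cauchy–Schwarz inequality for the Hessian at `x`, tested on `x` and
`eᵢ`. It is proved by induction on the degree. In degree two it is a discriminant condition forced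
by stability. In higher degree, Euler's identity writes the Hessian as a combination of the Hessians
of the first derivatives. Their inequalities add up to `A ≤ A²` for the Hessian `A` normalised to
have row sums one. Hence no eigenvalue lies strictly between 0 and 1. M-convexity makes the graph
connected, so the eigenvalue 1 is simple and all others are nonpositive.
`quadratic_form_nonpos_of_le_sum_sq_div` obtains this without spectral theory. -/

/-! ### Weighted graph Laplacians -/

open Matrix in
/-- The Fredholm alternative for a real symmetric matrix. -/
theorem Matrix.IsSymm.exists_mulVec_eq {ι : Type*} [Fintype ι] [DecidableEq ι]
    {L : Matrix ι ι ℝ} (hL : L.IsSymm) {b : ι → ℝ} (h : ∀ u, L *ᵥ u = 0 → b ⬝ᵥ u = 0) :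
    ∃ w, L *ᵥ w = b := by
  have hS : L.toEuclideanLin.IsSymmetric := isSymmetric_toEuclideanLin_iff.2 (by
    rw [Matrix.IsHermitian, Matrix.conjTranspose_eq_transpose_of_trivial]; exact hL)
  have hb : WithLp.toLp 2 b ∈ (LinearMap.range L.toEuclideanLin)ᗮᗮ := by
    rw [hS.orthogonal_range, Submodule.mem_orthogonal]
    intro u hu
    have := h u.ofLp (by simpa [Matrix.toLpLin_apply] using congrArg WithLp.ofLp (LinearMap.mem_ker.1 hu))
    simpa [EuclideanSpace.inner_eq_star_dotProduct] using this
  rw [Submodule.orthogonal_orthogonal] at hb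
  obtain ⟨w, hw⟩ := hb
  exact ⟨w.ofLp, by simpa [Matrix.toLpLin_apply] using congrArg WithLp.ofLp hw⟩

open Matrix in
/-- Cauchy–Schwarz inequality for a symmetric positive semidefinite form. -/
theorem Matrix.IsSymm.sq_dotProduct_mulVec_le {ι : Type*} [Fintype ι]
    {L : Matrix ι ι ℝ} (hL : L.IsSymm) (h : ∀ u, 0 ≤ u ⬝ᵥ L *ᵥ u) (v w : ι → ℝ) :
    (v ⬝ᵥ L *ᵥ w) ^ 2 ≤ (v ⬝ᵥ L *ᵥ v) * (w ⬝ᵥ L *ᵥ w) := by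
  have hs : w ⬝ᵥ L *ᵥ v = v ⬝ᵥ L *ᵥ w := by
    rw [dotProduct_mulVec, ← mulVec_transpose, hL.eq, dotProduct_comm]
  have := discrim_le_zero (a := v ⬝ᵥ L *ᵥ v) (b := 2 * (v ⬝ᵥ L *ᵥ w)) (c := w ⬝ᵥ L *ᵥ w)
    fun t => by
      have := h (t • v + w)
      simp only [mulVec_add, mulVec_smul, dotProduct_add, add_dotProduct, smul_dotProduct,
        dotProduct_smul, smul_eq_mul, hs] at this
      linarith
  rw [discrim] at this
  linarith

/-- The quadratic form of a weighted graph Laplacian. -/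
theorem sum_sum_mul_sub_sq {ι : Type*} [Fintype ι] {G : ι → ι → ℝ}
    (hG : ∀ i j, G i j = G j i) (u : ι → ℝ) :
    ∑ i, ∑ j, G i j * (u i - u j) ^ 2
      = 2 * (∑ i, (∑ j, G i j) * u i ^ 2 - ∑ i, u i * ∑ j, G i j * u j) := by
  have h1 : ∑ i, ∑ j, G i j * u j ^ 2 = ∑ i, ∑ j, G i j * u i ^ 2 := by
    rw [Finset.sum_comm]
    exact Finset.sum_congr rfl fun i _ => Finset.sum_congr rfl fun j _ => by rw [hG]
  have h2 : ∀ i j, G i j * (u i - u j) ^ 2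
      = G i j * u i ^ 2 + G i j * u j ^ 2 - 2 * (u i * (G i j * u j)) := fun i j => by ring
  simp only [h2, Finset.sum_add_distrib, Finset.sum_sub_distrib, h1, Finset.sum_mul,
    ← Finset.mul_sum]
  ring

open Matrix in
/-- Let `G` be a symmetric nonnegative matrix with row sums `g`, whose graph is connected on the
rows that do not vanish. If `u ↦ ∑ (G u)ᵢ² / gᵢ` dominates the quadratic form of `G`, then that form
is nonpositive on the orthogonal complement of `g`. -/
theorem quadratic_form_nonpos_of_le_sum_sq_div {ι : Type*} [Fintype ι] {G : ι → ι → ℝ}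
    (hG : ∀ i j, G i j = G j i) (hG0 : ∀ i j, 0 ≤ G i j)
    (hconn : ∀ u : ι → ℝ, (∀ i j, G i j ≠ 0 → u i = u j) →
      ∀ i j, ∑ k, G i k ≠ 0 → ∑ k, G j k ≠ 0 → u i = u j)
    (hle : ∀ u : ι → ℝ, ∑ i, u i * ∑ j, G i j * u j
      ≤ ∑ i, (∑ j, G i j * u j) ^ 2 / ∑ j, G i j)
    (v : ι → ℝ) (hv : ∑ i, (∑ j, G i j) * v i = 0) :
    ∑ i, v i * ∑ j, G i j * v j ≤ 0 := by
  classical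
  set g : ι → ℝ := fun i => ∑ j, G i j with hg
  have hGz : ∀ i, g i = 0 → ∀ j, G i j = 0 := fun i hi j =>
    (Finset.sum_eq_zero_iff_of_nonneg fun j _ => hG0 i j).1 hi j (Finset.mem_univ j)
  -- The graph Laplacian of `G`: positive semidefinite, with kernel consisting of functions constant
  -- along edges.
  let L : Matrix ι ι ℝ := Matrix.diagonal g - Matrix.of G
  have hLapp : ∀ u i, (L *ᵥ u) i = g i * u i - ∑ j, G i j * u j := fun u i => by
    rw [sub_mulVec, Pi.sub_apply, mulVec_diagonal]; rfl
  have hLform : ∀ u, u ⬝ᵥ L *ᵥ u = ∑ i, g i * u i ^ 2 - ∑ i, u i * ∑ j, G i j * u j := fun u => by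
    simp only [dotProduct, hLapp, mul_sub, Finset.sum_sub_distrib]
    congr 1
    exact Finset.sum_congr rfl fun i _ => by ring
  have hLsum : ∀ u, ∑ i, ∑ j, G i j * (u i - u j) ^ 2 = 2 * (u ⬝ᵥ L *ᵥ u) := fun u => by
    rw [hLform, sum_sum_mul_sub_sq hG]
  have hLsymm : L.IsSymm := by
    ext i j
    by_cases h : i = j
    · simp [h]
    · simp [L, h, Ne.symm h, hG i j]
  have hL0 : ∀ u, 0 ≤ u ⬝ᵥ L *ᵥ u := fun u => by
    have : 0 ≤ ∑ i, ∑ j, G i j * (u i - u j) ^ 2 :=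
      Finset.sum_nonneg fun i _ => Finset.sum_nonneg fun j _ => mul_nonneg (hG0 i j) (sq_nonneg _)
    linarith [hLsum u]
  -- Solvable because a kernel vector is constant on the nonvanishing rows, and `v` is
  -- `g`-orthogonal to constants.
  obtain ⟨w, hw⟩ := hLsymm.exists_mulVec_eq (b := fun i => g i * v i) (by
    intro u hu
    have hz : ∑ i, ∑ j, G i j * (u i - u j) ^ 2 = 0 := by rw [hLsum, hu]; simp
    have hz' : ∀ i j, G i j * (u i - u j) ^ 2 = 0 := fun i j =>
      (Finset.sum_eq_zero_iff_of_nonneg fun j _ => mul_nonneg (hG0 i j) (sq_nonneg _)).1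
        ((Finset.sum_eq_zero_iff_of_nonneg fun i _ => Finset.sum_nonneg fun j _ =>
          mul_nonneg (hG0 i j) (sq_nonneg _)).1 hz i (Finset.mem_univ i)) j (Finset.mem_univ j)
    have hc := hconn u fun i j hij => by
      rcases mul_eq_zero.1 (hz' i j) with h | h
      · exact absurd h hij
      · exact sub_eq_zero.1 (pow_eq_zero_iff two_ne_zero |>.1 h)
    by_cases hex : ∃ i, g i ≠ 0
    · obtain ⟨i₀, h₀⟩ := hex
      calc (fun i => g i * v i) ⬝ᵥ u = ∑ i, u i₀ * (g i * v i) := by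
            refine Finset.sum_congr rfl fun i _ => ?_
            by_cases hi : g i = 0
            · simp [hi]
            · rw [hc i i₀ hi h₀]; ring
        _ = 0 := by rw [← Finset.mul_sum, hv, mul_zero]
    · push Not at hex
      simp [dotProduct, hex])
  have hw' : ∀ i, ∑ j, G i j * w j = g i * w i - g i * v i := fun i => by
    have := congrFun hw i
    rw [hLapp] at this
    linarith
  have h1 := hle w
  have h2 := hLsymm.sq_dotProduct_mulVec_le hL0 v w
  have h3 : ∑ i, (∑ j, G i j * w j) ^ 2 / g i
      = ∑ i, g i * w i ^ 2 - 2 * (w ⬝ᵥ L *ᵥ w) + ∑ i, g i * v i ^ 2 := by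
    rw [hw]
    simp only [dotProduct, Finset.mul_sum, ← Finset.sum_sub_distrib, ← Finset.sum_add_distrib]
    refine Finset.sum_congr rfl fun i _ => ?_
    rw [hw']
    by_cases hi : g i = 0
    · simp [hi]
    · field_simp; ring
  have h4 : v ⬝ᵥ L *ᵥ w = ∑ i, g i * v i ^ 2 := by
    rw [hw]; exact Finset.sum_congr rfl fun i _ => by ring
  have h5 := hLform w
  have h6 := hLform v
  have hg0 : 0 ≤ ∑ i, g i * v i ^ 2 :=
    Finset.sum_nonneg fun i _ => mul_nonneg (Finset.sum_nonneg fun j _ => hG0 i j) (sq_nonneg _)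
  -- The domination hypothesis at `w`, where `G w = g (w - v)`. Since the right side equals `v ⬝ᵥ L
  -- *ᵥ w`, Cauchy–Schwarz for `L` then yields `∑ g v² ≤ v ⬝ᵥ L *ᵥ v`, which is the claim.
  have h7 : w ⬝ᵥ L *ᵥ w ≤ ∑ i, g i * v i ^ 2 := by linarith
  have h8 : (v ⬝ᵥ L *ᵥ w) ^ 2 ≤ (v ⬝ᵥ L *ᵥ v) * (v ⬝ᵥ L *ᵥ w) :=
    h2.trans (mul_le_mul_of_nonneg_left (h4 ▸ h7) (hL0 v))
  rcases hg0.eq_or_lt with h0 | h0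
  · have := hL0 v; linarith
  · have : v ⬝ᵥ L *ᵥ w ≤ v ⬝ᵥ L *ᵥ v := by
      rw [sq] at h8; exact le_of_mul_le_mul_right h8 (h4 ▸ h0)
    linarith

/-! ### The univariate bound for log-concave coefficients -/

/-- The probability that a binomial variable with mean `k` among `d` trials equals `k`, that is
`C(d, k) (k / d) ^ k ((d - k) / d) ^ (d - k)`. -/
noncomputable def binomialMode (d k : ℕ) : ℝ :=
  (d.choose k : ℝ) * ((k : ℝ) / d) ^ k * (((d : ℝ) - k) / d) ^ (d - k)

theorem binomialMode_nonneg (d k : ℕ) : 0 ≤ binomialMode d k := by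
  unfold binomialMode
  rcases le_or_gt k d with h | h
  · have : (0 : ℝ) ≤ (d : ℝ) - k := sub_nonneg.2 (by exact_mod_cast h)
    positivity
  · simp [Nat.choose_eq_zero_of_lt h]

theorem binomialMode_zero (d : ℕ) : binomialMode d 0 = 1 := by
  rcases Nat.eq_zero_or_pos d with rfl | h
  · simp [binomialMode]
  · have : (d : ℝ) ≠ 0 := by positivity
    simp [binomialMode, div_self this]

theorem binomialMode_self (d : ℕ) : binomialMode d d = 1 := by
  rcases Nat.eq_zero_or_pos d with rfl | h
  · simp [binomialMode]
  · have : (d : ℝ) ≠ 0 := by positivity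
    simp [binomialMode, div_self this]

/-- A lower bound `c t ^ m` for a polynomial of degree at most `m` on the positive axis is a lower
bound for the leading coefficient. -/
theorem le_leadingCoeff_of_mul_pow_le {m : ℕ} {c : ℝ} {b : ℕ → ℝ} (hb : ∀ k, 0 ≤ b k)
    (h : ∀ t : ℝ, 0 < t → c * t ^ m ≤ ∑ k ∈ Finset.range (m + 1), b k * t ^ k) : c ≤ b m := by
  by_contra! hc
  obtain rfl | m := m
  · have := h 1 one_pos
    simp at this
    linarith
  set M := ∑ k ∈ Finset.range (m + 1), b k
  have hM : 0 ≤ M := Finset.sum_nonneg fun k _ => hb k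
  -- For `t ≥ 1` the lower terms total at most `M * t ^ m`, so a positive gap `c - b (m + 1)` fails
  -- for large `t`.
  have key : ∀ t : ℝ, 1 ≤ t → (c - b (m + 1)) * t ≤ M := fun t ht => by
    have h1 := h t (by linarith)
    rw [Finset.sum_range_succ] at h1
    have h2 : ∑ k ∈ Finset.range (m + 1), b k * t ^ k ≤ M * t ^ m := by
      rw [Finset.sum_mul]
      refine Finset.sum_le_sum fun k hk => mul_le_mul_of_nonneg_left ?_ (hb k)
      exact pow_le_pow_right₀ ht (by have := Finset.mem_range.1 hk; omega)
    have h3 : (c - b (m + 1)) * t * t ^ m ≤ M * t ^ m := by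
      have : (c - b (m + 1)) * t * t ^ m = c * t ^ (m + 1) - b (m + 1) * t ^ (m + 1) := by ring
      linarith
    exact le_of_mul_le_mul_right h3 (by positivity)
  have hpos : 0 < c - b (m + 1) := by linarith
  have := key (M / (c - b (m + 1)) + 1) (by
    have : 0 ≤ M / (c - b (m + 1)) := by positivity
    linarith)
  have h2 : (c - b (m + 1)) * (M / (c - b (m + 1)) + 1) = M + (c - b (m + 1)) := by
    field_simp
  linarith

/-- A positive log-concave sequence lies below each of its geometric tangents. -/
theorem le_mul_pow_of_logConcave {p : ℕ → ℝ} {m d : ℕ} (hm : m + 1 ≤ d)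
    (hp : ∀ k, 0 ≤ p k) (hpos : ∀ k ≤ m + 1, 0 < p k)
    (hzero : ∀ k, p k = 0 → p (k + 1) = 0)
    (hlc : ∀ k, k + 2 ≤ d → p k * p (k + 2) ≤ p (k + 1) ^ 2) :
    ∀ j ≤ d, p j * (p (m + 1) / p m) ^ (m + 1) ≤ p (m + 1) * (p (m + 1) / p m) ^ j := by
  set s := p (m + 1) / p m with hs
  have hpm := hpos m (by omega)
  have hpm1 := hpos (m + 1) le_rfl
  have hs0 : 0 < s := div_pos hpm1 hpm
  -- Consecutive ratios decrease; stated without division because `p` may vanish beyond `m + 1`.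
  have hup : ∀ k, m + k + 1 ≤ d → p (m + k + 1) ≤ s * p (m + k) := by
    intro k
    induction k with
    | zero => intro _; simp only [add_zero, hs]; rw [div_mul_cancel₀ _ hpm.ne']
    | succ k ih =>
      intro hk
      have h1 := ih (by omega)
      have h2 := hlc (m + k) (by omega)
      rcases (hp (m + k)).eq_or_lt with h0 | h0
      · have e1 := hzero _ h0.symm
        have e2 := hzero _ e1
        show p (m + k + 1 + 1) ≤ s * p (m + k + 1)
        rw [e1, e2, mul_zero]
      · show p (m + k + 2) ≤ s * p (m + k + 1)
        have h3 : p (m + k) * p (m + k + 2) ≤ p (m + k) * (s * p (m + k + 1)) := by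
          nlinarith [hp (m + k + 1)]
        exact le_of_mul_le_mul_left h3 h0
  have hdown : ∀ k ≤ m, s * p (m - k) ≤ p (m - k + 1) := by
    intro k
    induction k with
    | zero => intro _; simp only [Nat.sub_zero, hs]; rw [div_mul_cancel₀ _ hpm.ne']
    | succ k ih =>
      intro hk
      have h1 := ih (by omega)
      have e : m - k = m - (k + 1) + 1 := by omega
      rw [e] at h1
      have h2 := hlc (m - (k + 1)) (by omega)
      have a := hpos (m - (k + 1)) (by omega)
      have b := hpos (m - (k + 1) + 1) (by omega)
      have h3 : p (m - (k + 1) + 1) * (s * p (m - (k + 1)))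
          ≤ p (m - (k + 1) + 1) * p (m - (k + 1) + 1) := by
        have := mul_le_mul_of_nonneg_left h1 a.le
        nlinarith
      exact le_of_mul_le_mul_left h3 b
  intro j hj
  rcases le_or_gt j m with hjm | hjm
  · have : ∀ k ≤ m + 1, p (m + 1 - k) * s ^ k ≤ p (m + 1) := by
      intro k
      induction k with
      | zero => intro _; simp
      | succ k ih =>
        intro hk
        have h1 := ih (by omega)
        have h2 := hdown k (by omega)
        have e1 : m + 1 - (k + 1) = m - k := by omega
        have e2 : m + 1 - k = m - k + 1 := by omega
        rw [e1]; rw [e2] at h1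
        calc p (m - k) * s ^ (k + 1) = s * p (m - k) * s ^ k := by ring
          _ ≤ p (m - k + 1) * s ^ k := mul_le_mul_of_nonneg_right h2 (by positivity)
          _ ≤ _ := h1
    have h1 := this (m + 1 - j) (by omega)
    rw [show m + 1 - (m + 1 - j) = j by omega] at h1
    calc p j * s ^ (m + 1) = p j * s ^ (m + 1 - j) * s ^ j := by
          rw [mul_assoc, ← pow_add]; congr 2; omega
      _ ≤ _ := mul_le_mul_of_nonneg_right h1 (by positivity)
  · have : ∀ k, m + 1 + k ≤ d → p (m + 1 + k) ≤ p (m + 1) * s ^ k := by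
      intro k
      induction k with
      | zero => intro _; simp
      | succ k ih =>
        intro hk
        have h1 := ih (by omega)
        have h2 := hup (k + 1) (by omega)
        rw [show m + 1 + (k + 1) = m + (k + 1) + 1 by omega]
        rw [show m + 1 + k = m + (k + 1) by omega] at h1
        calc p (m + (k + 1) + 1) ≤ s * p (m + (k + 1)) := h2
          _ ≤ s * (p (m + 1) * s ^ k) := mul_le_mul_of_nonneg_left h1 hs0.le
          _ = _ := by ring
    have h1 := this (j - (m + 1)) (by omega)
    rw [show m + 1 + (j - (m + 1)) = j by omega] at h1
    calc p j * s ^ (m + 1) ≤ p (m + 1) * s ^ (j - (m + 1)) * s ^ (m + 1) :=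
          mul_le_mul_of_nonneg_right h1 (by positivity)
      _ = _ := by rw [mul_assoc, ← pow_add]; congr 2; omega

/-- The coefficient bound for a univariate polynomial `∑ q k / k! * t ^ k` of degree at most `d`
with ultra-log-concave coefficients without internal zeros. -/
theorem binomialMode_mul_le_of_logConcave {d m : ℕ} {c : ℝ} {q : ℕ → ℝ} (hq : ∀ k, 0 ≤ q k)
    (hzero : ∀ k, q k = 0 → q (k + 1) = 0)
    (hlc : ∀ k, k + 2 ≤ d → ((d - k : ℕ) : ℝ) * (q k * q (k + 2))
      ≤ ((d - k - 1 : ℕ) : ℝ) * q (k + 1) ^ 2)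
    (hc : 0 ≤ c)
    (h : ∀ t : ℝ, 0 < t →
      c * t ^ m ≤ ∑ k ∈ Finset.range (d + 1), q k / (k.factorial : ℝ) * t ^ k) :
    binomialMode d m * c ≤ q m / (m.factorial : ℝ) := by
  have hb : ∀ k, 0 ≤ q k / (k.factorial : ℝ) := fun k => div_nonneg (hq k) (by positivity)
  rcases lt_or_ge d m with hdm | hdm
  · simpa [binomialMode, Nat.choose_eq_zero_of_lt hdm] using hb m
  -- Then all later coefficients vanish too, so the polynomial has degree below `m` and `c` must be
  -- zero.
  by_cases hqm : q m = 0
  · have hz : ∀ k, q (m + k) = 0 := fun k => by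
      induction k with
      | zero => exact hqm
      | succ k ih => exact hzero _ ih
    have : c ≤ q m / (m.factorial : ℝ) := by
      refine le_leadingCoeff_of_mul_pow_le (b := fun k => q k / (k.factorial : ℝ)) hb
        fun t ht => (h t ht).trans (le_of_eq ?_)
      symm
      refine Finset.sum_subset (Finset.range_subset_range.2 (by omega)) fun k _ hk => ?_
      obtain ⟨l, rfl⟩ := Nat.exists_eq_add_of_le (show m ≤ k by
        have := mt Finset.mem_range.2 hk; omega)
      simp [hz]
    rw [hqm, zero_div] at this ⊢
    rw [le_antisymm this hc, mul_zero]
  -- The extreme indices are limits, `t → ∞` for `m = d` and `t → 0` for `m = 0`; the optimal `t`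
  -- below exists only strictly between them.
  rcases hdm.eq_or_lt with rfl | hdm'
  · rw [binomialMode_self, one_mul]
    exact le_leadingCoeff_of_mul_pow_le (b := fun k => q k / (k.factorial : ℝ)) hb h
  obtain rfl | m := m
  · rw [binomialMode_zero, one_mul]
    have hcont : Continuous fun t : ℝ =>
        ∑ k ∈ Finset.range (d + 1), q k / (k.factorial : ℝ) * t ^ k := by fun_prop
    have := ge_of_tendsto (hcont.continuousWithinAt (s := Set.Ioi 0) (x := 0))
      (Filter.eventually_of_mem self_mem_nhdsWithin fun t ht => by simpa using h t ht)
    beta_reduce at this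
    rw [Finset.sum_range_succ'] at this
    simpa using this
  have hqpos : ∀ k ≤ m + 1, 0 < q k := by
    intro k hk
    refine (hq k).lt_of_ne fun h0 => hqm ?_
    obtain ⟨l, hl⟩ := Nat.exists_eq_add_of_le hk
    rw [hl]
    clear hl
    induction l with
    | zero => exact h0.symm
    | succ l ih => exact hzero _ ih
  -- This weight turns `hlc` into plain log-concavity and makes `q j / j!` equal to `p j / d!` times
  -- `d.choose j`.
  set p : ℕ → ℝ := fun k => q k * ((d - k).factorial : ℝ) with hp
  have hpos : ∀ k ≤ m + 1, 0 < p k := fun k hk => mul_pos (hqpos k hk) (by positivity)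
  have htan := le_mul_pow_of_logConcave (p := p) hdm (fun k => mul_nonneg (hq k) (by positivity))
    hpos (fun k hk => by
      have : q k = 0 := by
        rcases mul_eq_zero.1 hk with h | h
        · exact h
        · exact absurd h (by positivity)
      simp [hp, hzero k this])
    (fun k hk => by
      obtain ⟨l, rfl⟩ := Nat.exists_eq_add_of_le hk
      have := hlc k hk
      rw [show k + 2 + l - k = l + 2 by omega] at this
      simp only [hp, show k + 2 + l - k = l + 2 by omega, show k + 2 + l - (k + 2) = l by omega,
        show k + 2 + l - (k + 1) = l + 1 by omega, Nat.factorial_succ]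
      simp only [show l + 2 - 1 = l + 1 by omega] at this
      push_cast at this ⊢
      have h2 := mul_le_mul_of_nonneg_right this
        (show (0 : ℝ) ≤ ((l : ℝ) + 1) * (l.factorial : ℝ) ^ 2 by positivity)
      calc _ = ((l : ℝ) + 2) * (q k * q (k + 2)) * (((l : ℝ) + 1) * (l.factorial : ℝ) ^ 2) := by
            ring
        _ ≤ _ := h2
        _ = _ := by ring)
  set s := p (m + 1) / p m with hs
  have hs0 : 0 < s := div_pos (hpos _ le_rfl) (hpos _ (by omega))
  obtain ⟨e, rfl⟩ := Nat.exists_eq_add_of_lt hdm'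
  set k := m + 1 with hk
  have hkpos : (0 : ℝ) < k := by rw [hk]; positivity
  set d := k + e + 1 with hd
  have hdk : (d : ℝ) - k = (e : ℝ) + 1 := by rw [hd]; push_cast; ring
  have hdk' : d - k = e + 1 := by omega
  -- The minimiser of `(1 + u) ^ d / u ^ k`, as `e + 1 = d - k`; the minimum produces the binomial
  -- constant.
  set u : ℝ := k / (e + 1) with hu
  have hupos : 0 < u := by positivity
  have h1u : 1 + u = d / (e + 1) := by
    rw [hu, show (d : ℝ) = k + (e + 1) by linarith]; field_simp; ring
  have key : c * u ^ k ≤ p k / (d.factorial : ℝ) * (1 + u) ^ d := by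
    have h1 := h (u / s) (by positivity)
    have h2 : ∑ j ∈ Finset.range (d + 1), q j / (j.factorial : ℝ) * (u / s) ^ j * s ^ k
        ≤ ∑ j ∈ Finset.range (d + 1), p k / (d.factorial : ℝ) * (u ^ j * (d.choose j : ℝ)) := by
      refine Finset.sum_le_sum fun j hj => ?_
      have hjd : j ≤ d := by have := Finset.mem_range.1 hj; omega
      have h3 := htan j hjd
      have hch : (d.choose j : ℝ) * (j.factorial : ℝ) * ((d - j).factorial : ℝ)
          = (d.factorial : ℝ) := by exact_mod_cast Nat.choose_mul_factorial_mul_factorial hjd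
      have hf1 : (0 : ℝ) < j.factorial := by positivity
      have hf2 : (0 : ℝ) < (d - j).factorial := by positivity
      have hcpos : (0 : ℝ) < d.choose j := by exact_mod_cast Nat.choose_pos hjd
      rw [← hch]
      calc q j / (j.factorial : ℝ) * (u / s) ^ j * s ^ k
          = p j * s ^ k * (u ^ j / (j.factorial * (d - j).factorial * s ^ j)) := by
            simp only [hp]; rw [div_pow]; field_simp
        _ ≤ p k * s ^ j * (u ^ j / (j.factorial * (d - j).factorial * s ^ j)) :=
            mul_le_mul_of_nonneg_right h3 (by positivity)
        _ = _ := by field_simp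
    rw [← Finset.sum_mul, ← Finset.mul_sum] at h2
    have h4 : (1 + u) ^ d = ∑ j ∈ Finset.range (d + 1), u ^ j * (d.choose j : ℝ) := by
      rw [add_comm, add_pow]; simp
    rw [h4]
    calc c * u ^ k = c * (u / s) ^ k * s ^ k := by
          rw [mul_assoc, ← mul_pow, div_mul_cancel₀ _ hs0.ne']
      _ ≤ _ := mul_le_mul_of_nonneg_right h1 (by positivity)
      _ ≤ _ := h2
  have hch : (d.choose k : ℝ) * (k.factorial : ℝ) * ((e + 1).factorial : ℝ)
      = (d.factorial : ℝ) := by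
    rw [← hdk']; exact_mod_cast Nat.choose_mul_factorial_mul_factorial hdm
  have hcpos : (0 : ℝ) < d.choose k := by exact_mod_cast Nat.choose_pos hdm
  have hdpos : (0 : ℝ) < d := by rw [hd]; positivity
  have hpk : p k / (d.factorial : ℝ) = q k / (k.factorial : ℝ) / d.choose k := by
    simp only [hp]; rw [hdk', ← hch]; field_simp
  rw [hpk, h1u, hu] at key
  rw [binomialMode, hdk, hdk']
  have e1 : ((d : ℝ)) ^ d = d ^ k * d ^ (e + 1) := by rw [← pow_add]; rfl
  have e2 : ((e : ℝ) + 1) ^ d = (e + 1) ^ k * (e + 1) ^ (e + 1) := by rw [← pow_add]; rfl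
  have h5 := mul_le_mul_of_nonneg_right key
    (show (0 : ℝ) ≤ d.choose k * ((e + 1) ^ d / d ^ d) by positivity)
  calc _ = c * ((k : ℝ) / (e + 1)) ^ k * (d.choose k * ((e + 1) ^ d / d ^ d)) := by
        rw [e1, e2]; simp only [div_pow]; field_simp
    _ ≤ _ := h5
    _ = _ := by simp only [div_pow]; field_simp

/-! ### Derivatives of homogeneous polynomials -/

theorem MvPolynomial.pderiv_pderiv_comm {σ R : Type*} [CommRing R] (i j : σ) (p : MvPolynomial σ R) :
    pderiv i (pderiv j p) = pderiv j (pderiv i p) := by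
  ext m
  simp only [coeff_pderiv, Finsupp.add_apply]
  classical
  by_cases h : i = j
  · simp [h]
  · rw [add_right_comm]
    simp [h, Ne.symm h]
    ring

open MvPolynomial

theorem MvPolynomial.eval_nonneg_of_coeff_nonneg {σ : Type*} {P : MvPolynomial σ ℝ}
    (hP : ∀ m, 0 ≤ P.coeff m) {x : σ → ℝ} (hx : ∀ i, 0 < x i) : 0 ≤ eval x P := by
  rw [eval_eq]
  exact Finset.sum_nonneg fun m _ => mul_nonneg (hP m)
    (Finset.prod_nonneg fun i _ => pow_nonneg (hx i).le _)

theorem MvPolynomial.eval_pos_of_coeff_nonneg {σ : Type*} {P : MvPolynomial σ ℝ}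
    (hP : ∀ m, 0 ≤ P.coeff m) (h0 : P ≠ 0) {x : σ → ℝ} (hx : ∀ i, 0 < x i) : 0 < eval x P := by
  rw [eval_eq]
  exact Finset.sum_pos (fun m hm => mul_pos ((hP m).lt_of_ne (mem_support_iff.1 hm).symm)
    (Finset.prod_pos fun i _ => pow_pos (hx i) _)) (support_nonempty.2 h0)

theorem MvPolynomial.coeff_pderiv_nonneg {σ : Type*} {P : MvPolynomial σ ℝ}
    (hP : ∀ m, 0 ≤ P.coeff m) (i : σ) (m : σ →₀ ℕ) : 0 ≤ (pderiv i P).coeff m := by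
  rw [coeff_pderiv]
  exact mul_nonneg (hP _) (by positivity)

theorem MvPolynomial.pderiv_ne_zero_iff {σ : Type*} {P : MvPolynomial σ ℝ} {i : σ} :
    pderiv i P ≠ 0 ↔ ∃ m ∈ P.support, m i ≠ 0 := by
  classical
  rw [MvPolynomial.ne_zero_iff]
  constructor
  · rintro ⟨m, hm⟩
    rw [coeff_pderiv] at hm
    exact ⟨m + Finsupp.single i 1, mem_support_iff.2 (left_ne_zero_of_mul hm), by simp⟩
  · rintro ⟨m, hm, hi⟩
    refine ⟨m - Finsupp.single i 1, ?_⟩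
    rw [coeff_pderiv, tsub_add_cancel_of_le
      (Finsupp.single_le_iff.2 (Nat.one_le_iff_ne_zero.2 hi))]
    exact mul_ne_zero (mem_support_iff.1 hm) (by positivity)

theorem MvPolynomial.pderiv_pderiv_ne_zero {σ : Type*} {P : MvPolynomial σ ℝ} {i j : σ}
    (hij : i ≠ j) {m : σ →₀ ℕ} (hm : m ∈ P.support) (hi : m i ≠ 0) (hj : m j ≠ 0) :
    pderiv i (pderiv j P) ≠ 0 := by
  classical
  refine pderiv_ne_zero_iff.2 ⟨m - Finsupp.single j 1, ?_, ?_⟩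
  · rw [mem_support_iff, coeff_pderiv, tsub_add_cancel_of_le
      (Finsupp.single_le_iff.2 (Nat.one_le_iff_ne_zero.2 hj))]
    exact mul_ne_zero (mem_support_iff.1 hm) (by positivity)
  · simpa [Finsupp.single_apply, hij.symm] using hi

theorem MvPolynomial.IsHomogeneous.eq_C {σ R : Type*} [CommSemiring R] {P : MvPolynomial σ R}
    (h : P.IsHomogeneous 0) : P = C (P.coeff 0) :=
  totalDegree_eq_zero_iff_eq_C.1 ((totalDegree_zero_iff_isHomogeneous _).2 h)

theorem MvPolynomial.IsHomogeneous.pderiv_eq_zero {σ R : Type*} [CommSemiring R]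
    {P : MvPolynomial σ R} (h : P.IsHomogeneous 0) (i : σ) : MvPolynomial.pderiv i P = 0 := by
  rw [h.eq_C, pderiv_C]

theorem MvPolynomial.IsHomogeneous.sum_mul_eval_pderiv {σ : Type*} [Fintype σ]
    {P : MvPolynomial σ ℝ} {d : ℕ} (h : P.IsHomogeneous d) (x : σ → ℝ) :
    ∑ i, x i * eval x (MvPolynomial.pderiv i P) = d * eval x P := by
  simpa using congrArg (eval x) h.sum_X_mul_pderiv

theorem MvPolynomial.IsHomogeneous.iterate_pderiv {σ R : Type*} [CommSemiring R]
    {P : MvPolynomial σ R} {d : ℕ} (h : P.IsHomogeneous d) (i : σ) (k : ℕ) :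
    ((MvPolynomial.pderiv i)^[k] P).IsHomogeneous (d - k) := by
  induction k with
  | zero => exact h
  | succ k ih => rw [Function.iterate_succ_apply']; exact ih.pderiv

theorem MvPolynomial.IsHomogeneous.iterate_pderiv_eq_zero {σ R : Type*} [CommSemiring R]
    {P : MvPolynomial σ R} {d : ℕ} (h : P.IsHomogeneous d) (i : σ) {k : ℕ} (hk : d < k) :
    (MvPolynomial.pderiv i)^[k] P = 0 := by
  obtain ⟨k, rfl⟩ := Nat.exists_eq_succ_of_ne_zero (show k ≠ 0 by omega)
  rw [Function.iterate_succ_apply']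
  have := h.iterate_pderiv i k
  rw [show d - k = 0 by omega] at this
  exact this.pderiv_eq_zero i

theorem MvPolynomial.coeff_iterate_pderiv {σ : Type*} (P : MvPolynomial σ ℝ) (i : σ) (k : ℕ)
    {m : σ →₀ ℕ} (hm : m i = 0) :
    ((pderiv i)^[k] P).coeff m = P.coeff (m + Finsupp.single i k) * k.factorial := by
  classical
  induction k generalizing P with
  | zero => simp
  | succ k ih =>
    rw [Function.iterate_succ_apply, ih, coeff_pderiv, add_assoc, ← Finsupp.single_add]
    simp [hm, Nat.factorial_succ]
    ring

/-- Taylor expansion of a polynomial in one of its variables. -/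
theorem MvPolynomial.IsHomogeneous.eval_add_single {σ : Type*} [DecidableEq σ]
    {P : MvPolynomial σ ℝ}
    {d e : ℕ} (h : P.IsHomogeneous e) (hed : e ≤ d) (i : σ) (x : σ → ℝ) (t : ℝ) :
    eval (x + Pi.single i t) P = ∑ k ∈ Finset.range (d + 1),
      eval x ((MvPolynomial.pderiv i)^[k] P) / (k.factorial : ℝ) * t ^ k := by
  -- The line `x + X eᵢ` as a point over `Polynomial ℝ`; univariate differentiation then corresponds
  -- to `pderiv i`.
  let y : σ → Polynomial ℝ := fun j => 
    Polynomial.C (x j) + (Pi.single i Polynomial.X : σ → Polynomial ℝ) j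
  have hy : ∀ s (Q : MvPolynomial σ ℝ), (MvPolynomial.aeval y Q).eval s = eval (x + Pi.single i s) Q := by
    intro s Q
    rw [← Polynomial.coe_evalRingHom, ← AlgHom.coe_toRingHom, ← RingHom.comp_apply]
    refine congrFun (congrArg DFunLike.coe (MvPolynomial.ringHom_ext (fun r => ?_) fun j => ?_)) Q
    · simp
    · by_cases hj : j = i
      · subst hj; simp [y]
      · simp [y, hj]
  have hder : ∀ Q : MvPolynomial σ ℝ,
      Polynomial.derivative (MvPolynomial.aeval y Q) = MvPolynomial.aeval y (MvPolynomial.pderiv i Q) := by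
    intro Q
    induction Q using MvPolynomial.induction_on with
    | C a => simp
    | add p q hp hq => simp [hp, hq]
    | mul_X p j hp =>
      rw [map_mul, Polynomial.derivative_mul, hp, pderiv_mul, aeval_X, map_add (MvPolynomial.aeval y),
        map_mul, map_mul,
        aeval_X]
      congr 2
      by_cases hj : j = i
      · subst hj; simp [y]
      · simp [y, hj, pderiv_X_of_ne hj]
  have hiter : ∀ k, Polynomial.derivative^[k] (MvPolynomial.aeval y P)
      = MvPolynomial.aeval y ((MvPolynomial.pderiv i)^[k] P) := fun k => by
    induction k with
    | zero => rfl
    | succ k ih => rw [Function.iterate_succ_apply', ih, hder, Function.iterate_succ_apply']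
  have hcoeff : ∀ k, (MvPolynomial.aeval y P).coeff k
      = eval x ((MvPolynomial.pderiv i)^[k] P) / (k.factorial : ℝ) := fun k => by
    have h1 := Polynomial.coeff_iterate_derivative (k := k) (MvPolynomial.aeval y P) 0
    rw [hiter, Polynomial.coeff_zero_eq_eval_zero, hy] at h1
    simp only [Pi.single_zero, add_zero, zero_add, Nat.descFactorial_self, nsmul_eq_mul] at h1
    rw [h1]
    field_simp
  have hdeg : (MvPolynomial.aeval y P).natDegree ≤ d := Polynomial.natDegree_le_iff_coeff_eq_zero.2 fun k hk => by
    rw [hcoeff, h.iterate_pderiv_eq_zero i (hed.trans_lt hk)]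
    simp
  rw [← hy, Polynomial.eval_eq_sum_range' (Nat.lt_succ_of_le hdeg)]
  simp only [hcoeff]

/-! ### Basic closure properties of Lorentzian polynomials -/

theorem IsLorentzian.isHomogeneous {σ : Type*} {d : ℕ} {P : MvPolynomial σ ℝ}
    (hP : IsLorentzian d P) : P.IsHomogeneous d := by
  match d, hP with
  | 0, h => exact h.1
  | 1, h => exact h.1
  | 2, h => exact h.1
  | _ + 3, h => exact h.1

/-- From degree three on the definition does not mention signs; they descend from a derivative, in
which each coefficient reappears with a positive factor. -/
theorem IsLorentzian.coeff_nonneg {σ : Type*} {d : ℕ} {P : MvPolynomial σ ℝ}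
    (hP : IsLorentzian d P) (m : σ →₀ ℕ) : 0 ≤ P.coeff m := by
  induction d generalizing P m with
  | zero => exact hP.2.1 m
  | succ d ih =>
    match d, hP with
    | 0, h => exact h.2.1 m
    | 1, h => exact h.2.1 m
    | d + 2, h =>
      by_cases hm : P.coeff m = 0
      · exact hm.ge
      have hdeg : m.degree = d + 3 := by
        by_contra hne; exact hm (h.1.coeff_eq_zero hne)
      obtain ⟨i, hi⟩ : ∃ i, m i ≠ 0 := by
        by_contra! h0
        have : m = 0 := Finsupp.ext h0
        simp [this] at hdeg
      have := ih (h.2.2 i) (m - Finsupp.single i 1)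
      rw [coeff_pderiv, tsub_add_cancel_of_le
        (Finsupp.single_le_iff.2 (Nat.one_le_iff_ne_zero.2 hi))] at this
      exact nonneg_of_mul_nonneg_left this (by positivity)

theorem isRealStable_of_isHomogeneous_zero {σ : Type*} {P : MvPolynomial σ ℝ}
    (h : P.IsHomogeneous 0) : IsRealStable P := by
  by_cases h0 : P = 0
  · exact Or.inl h0
  · refine Or.inr fun z _ => ?_
    rw [h.eq_C] at h0 ⊢
    simpa [MvPolynomial.algebraMap_eq] using h0

/-- The imaginary part of `∑ cᵢ zᵢ` is `∑ cᵢ Im zᵢ`, which vanishes only if every `cᵢ` does. -/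
theorem isRealStable_of_isHomogeneous_one {σ : Type*} [Fintype σ] {P : MvPolynomial σ ℝ}
    (h : P.IsHomogeneous 1) (hc : ∀ m, 0 ≤ P.coeff m) : IsRealStable P := by
  by_cases h0 : P = 0
  · exact Or.inl h0
  refine Or.inr fun z hz hzero => ?_
  have hd : ∀ i, pderiv i P = C ((pderiv i P).coeff 0) := fun i => (h.pderiv (i := i)).eq_C
  have hE : ∑ i, X i * pderiv i P = P := by simpa using h.sum_X_mul_pderiv
  have him : ∑ i, (z i).im * (pderiv i P).coeff 0 = 0 := by
    have h1 := congrArg Complex.im hzero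
    rw [← hE, map_sum, Complex.im_sum, Complex.zero_im] at h1
    rw [← h1]
    refine Finset.sum_congr rfl fun i _ => ?_
    conv_rhs => rw [hd i]
    simp
  have hall := (Finset.sum_eq_zero_iff_of_nonneg fun i _ =>
    mul_nonneg (hz i).le (coeff_pderiv_nonneg hc i 0)).1 him
  refine h0 (hE ▸ Finset.sum_eq_zero fun i hi => ?_)
  rw [hd i, (mul_eq_zero.1 (hall i hi)).resolve_left (hz i).ne', C_0, mul_zero]

/-- Only degree at most two needs an argument: the derivative is then constant or linear, where
stability is automatic. -/
theorem IsLorentzian.pderiv {σ : Type*} [Fintype σ] {d : ℕ} {P : MvPolynomial σ ℝ}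
    (hP : IsLorentzian d P) (i : σ) : IsLorentzian (d - 1) (MvPolynomial.pderiv i P) := by
  have hh := hP.isHomogeneous.pderiv (i := i)
  have hc := coeff_pderiv_nonneg hP.coeff_nonneg i
  match d, hP with
  | 0, _ => exact ⟨hh, hc, isRealStable_of_isHomogeneous_zero hh⟩
  | 1, _ => exact ⟨hh, hc, isRealStable_of_isHomogeneous_zero hh⟩
  | 2, _ => exact ⟨hh, hc, isRealStable_of_isHomogeneous_one hh hc⟩
  | _ + 3, h => exact h.2.2 i

theorem IsLorentzian.iterate_pderiv {σ : Type*} [Fintype σ] {d : ℕ} {P : MvPolynomial σ ℝ}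
    (hP : IsLorentzian d P) (i : σ) (k : ℕ) :
    IsLorentzian (d - k) ((MvPolynomial.pderiv i)^[k] P) := by
  induction k with
  | zero => exact hP
  | succ k ih => rw [Function.iterate_succ_apply']; exact ih.pderiv i

/-! ### Reverse Cauchy–Schwarz for the Hessian -/

open Matrix

/-- The Hessian matrix of a polynomial at a point. -/
noncomputable def MvPolynomial.hessian {σ : Type*} (P : MvPolynomial σ ℝ) (x : σ → ℝ) :
    Matrix σ σ ℝ :=
  Matrix.of fun i j => eval x (pderiv i (pderiv j P))

theorem MvPolynomial.hessian_isSymm {σ : Type*} (P : MvPolynomial σ ℝ) (x : σ → ℝ) :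
    (P.hessian x).IsSymm := by
  ext i j
  simp [hessian, pderiv_pderiv_comm i j]

theorem MvPolynomial.IsHomogeneous.hessian_mulVec_self {σ : Type*} [Fintype σ]
    {P : MvPolynomial σ ℝ} {d : ℕ} (h : P.IsHomogeneous d) (x : σ → ℝ) (i : σ) :
    (P.hessian x *ᵥ x) i = (d - 1 : ℕ) * eval x (MvPolynomial.pderiv i P) := by
  rw [← (h.pderiv (i := i)).sum_mul_eval_pderiv x]
  exact Finset.sum_congr rfl fun j _ => by simp [hessian, pderiv_pderiv_comm i j, mul_comm]

/-- Euler's identity for the first derivatives says that the Hessian sends `x` to `d - 1` times the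
gradient. -/
theorem MvPolynomial.IsHomogeneous.self_dotProduct_hessian_mulVec {σ : Type*} [Fintype σ]
    {P : MvPolynomial σ ℝ} {d : ℕ} (h : P.IsHomogeneous d) (x v : σ → ℝ) :
    x ⬝ᵥ P.hessian x *ᵥ v = (d - 1 : ℕ) * ∑ i, v i * eval x (MvPolynomial.pderiv i P) := by
  rw [dotProduct_mulVec, ← mulVec_transpose, (hessian_isSymm P x).eq, dotProduct_comm,
    dotProduct, Finset.mul_sum]
  exact Finset.sum_congr rfl fun i _ => by rw [h.hessian_mulVec_self]; ring

theorem Matrix.IsSymm.dotProduct_mulVec_comm {ι : Type*} [Fintype ι] {H : Matrix ι ι ℝ}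
    (hH : H.IsSymm) (v w : ι → ℝ) : w ⬝ᵥ H *ᵥ v = v ⬝ᵥ H *ᵥ w := by
  rw [dotProduct_mulVec, ← mulVec_transpose, hH.eq, dotProduct_comm]

/-- A symmetric form that is nonpositive on the orthogonal complement of a nonnegative vector `x`
satisfies the reverse Cauchy–Schwarz inequality with respect to `x`. -/
theorem Matrix.IsSymm.reverse_cauchySchwarz {ι : Type*} [Fintype ι] {H : Matrix ι ι ℝ}
    (hH : H.IsSymm) {x : ι → ℝ} (hx : 0 ≤ x ⬝ᵥ H *ᵥ x)
    (h : ∀ v, x ⬝ᵥ H *ᵥ v = 0 → v ⬝ᵥ H *ᵥ v ≤ 0) (v : ι → ℝ) :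
    (x ⬝ᵥ H *ᵥ x) * (v ⬝ᵥ H *ᵥ v) ≤ (x ⬝ᵥ H *ᵥ v) ^ 2 := by
  rcases hx.eq_or_lt with h0 | h0
  · rw [← h0, zero_mul]; exact sq_nonneg _
  have h1 : ∀ a : ℝ, x ⬝ᵥ H *ᵥ (v + a • x) = x ⬝ᵥ H *ᵥ v + a * (x ⬝ᵥ H *ᵥ x) := fun a => by
    simp [mulVec_add, mulVec_smul]
  have h2 : ∀ a : ℝ, (v + a • x) ⬝ᵥ H *ᵥ (v + a • x)
      = v ⬝ᵥ H *ᵥ v + 2 * a * (x ⬝ᵥ H *ᵥ v) + a ^ 2 * (x ⬝ᵥ H *ᵥ x) := fun a => by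
    simp only [mulVec_add, mulVec_smul, dotProduct_add, add_dotProduct, smul_dotProduct,
      dotProduct_smul, smul_eq_mul, hH.dotProduct_mulVec_comm x v]
    ring
  -- The component of `v` that is `H`-orthogonal to `x`.
  have h3 := h (v + (-(x ⬝ᵥ H *ᵥ v) / (x ⬝ᵥ H *ᵥ x)) • x) (by rw [h1]; field_simp; ring)
  rw [h2] at h3
  have h4 := mul_le_mul_of_nonneg_left h3 hx
  rw [mul_zero] at h4
  have h5 : (x ⬝ᵥ H *ᵥ x) * (v ⬝ᵥ H *ᵥ v + 2 * (-(x ⬝ᵥ H *ᵥ v) / (x ⬝ᵥ H *ᵥ x)) * (x ⬝ᵥ H *ᵥ v)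
      + (-(x ⬝ᵥ H *ᵥ v) / (x ⬝ᵥ H *ᵥ x)) ^ 2 * (x ⬝ᵥ H *ᵥ x))
      = (x ⬝ᵥ H *ᵥ x) * (v ⬝ᵥ H *ᵥ v) - (x ⬝ᵥ H *ᵥ v) ^ 2 := by
    field_simp; ring
  linarith

theorem IsLorentzian.self_dotProduct_hessian_nonneg {σ : Type*} [Fintype σ] {d : ℕ}
    {P : MvPolynomial σ ℝ} (hP : IsLorentzian d P) {x : σ → ℝ} (hx : ∀ i, 0 < x i) :
    0 ≤ x ⬝ᵥ P.hessian x *ᵥ x := by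
  rw [hP.isHomogeneous.self_dotProduct_hessian_mulVec]
  exact mul_nonneg (by positivity) (Finset.sum_nonneg fun i _ => mul_nonneg (hx i).le
    (eval_nonneg_of_coeff_nonneg (coeff_pderiv_nonneg hP.coeff_nonneg i) hx))

/-- A quadratic form is given by its Hessian. -/
theorem MvPolynomial.IsHomogeneous.two_mul_aeval {σ : Type*} [Fintype σ] {P : MvPolynomial σ ℝ}
    (h : P.IsHomogeneous 2) (x : σ → ℝ) (z : σ → ℂ) :
    2 * MvPolynomial.aeval z P = ∑ i, z i * ∑ j, (P.hessian x i j : ℂ) * z j := by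
  have h1 := congrArg (MvPolynomial.aeval z) h.sum_X_mul_pderiv
  rw [map_sum, map_nsmul, nsmul_eq_mul, Nat.cast_ofNat] at h1
  rw [← h1]
  refine Finset.sum_congr rfl fun i _ => ?_
  rw [map_mul, aeval_X]
  congr 1
  have h2 := (h.pderiv (i := i)).sum_X_mul_pderiv
  rw [show 2 - 1 = 1 from rfl, one_smul] at h2
  rw [← h2, map_sum]
  refine Finset.sum_congr rfl fun j _ => ?_
  have h3 : (MvPolynomial.pderiv j (MvPolynomial.pderiv i P)).IsHomogeneous 0 :=
    (h.pderiv (i := i)).pderiv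
  rw [map_mul, aeval_X, hessian, Matrix.of_apply, pderiv_pderiv_comm i j, h3.eq_C]
  simp [mul_comm]

/-- Otherwise the quadratic `t ↦ P(v + t x)` has negative discriminant, and its root in the upper
half-plane gives a zero of `P` forbidden by stability, since `x > 0`. -/
theorem reverse_cauchySchwarz_of_isRealStable {σ : Type*} [Fintype σ] {P : MvPolynomial σ ℝ}
    (hP : P.IsHomogeneous 2) (hS : IsRealStable P) {x : σ → ℝ} (hx : ∀ i, 0 < x i)
    (hxx : 0 ≤ x ⬝ᵥ P.hessian x *ᵥ x) (v : σ → ℝ) :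
    (x ⬝ᵥ P.hessian x *ᵥ x) * (v ⬝ᵥ P.hessian x *ᵥ v) ≤ (x ⬝ᵥ P.hessian x *ᵥ v) ^ 2 := by
  rcases hS with rfl | hS
  · have : (0 : MvPolynomial σ ℝ).hessian x = 0 := by ext; simp [hessian]
    simp [this]
  by_contra! hlt
  set H := P.hessian x with hH
  set A := x ⬝ᵥ H *ᵥ x
  set B := x ⬝ᵥ H *ᵥ v with hB
  set D := v ⬝ᵥ H *ᵥ v
  have hA : 0 < A := hxx.lt_of_ne fun h => by
    rw [← h, zero_mul] at hlt
    exact absurd hlt (not_lt.2 (sq_nonneg _))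
  set s := Real.sqrt (A * D - B ^ 2)
  have hs : 0 < s := Real.sqrt_pos.2 (sub_pos.2 hlt)
  have hs2 : (s : ℂ) ^ 2 = A * D - B ^ 2 := by
    exact_mod_cast Real.sq_sqrt (sub_pos.2 hlt).le
  let t : ℂ := ⟨-B / A, s / A⟩
  have ht : t = (-B + s * Complex.I) / A := by
    have : (A : ℂ) ≠ 0 := by exact_mod_cast hA.ne'
    rw [eq_div_iff this]
    apply Complex.ext <;> simp [t] <;> field_simp
  have hexp : ∀ t : ℂ, ∑ i, ((v i : ℂ) + t * x i) * ∑ j, (H i j : ℂ) * (v j + t * x j)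
      = D + 2 * B * t + A * t ^ 2 := fun t => by
    have hsym : B = v ⬝ᵥ H *ᵥ x := ((hessian_isSymm P x).dotProduct_mulVec_comm x v).symm
    have e : (D : ℂ) + 2 * B * t + A * t ^ 2
        = D + ((v ⬝ᵥ H *ᵥ x : ℝ) : ℂ) * t + B * t + A * t ^ 2 := by rw [← hsym]; ring
    rw [e]
    simp only [A, hB, D, dotProduct, mulVec, Complex.ofReal_sum, Complex.ofReal_mul, mul_add,
      add_mul, Finset.sum_add_distrib, Finset.mul_sum, Finset.sum_mul]
    simp only [← add_assoc]
    congr 1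
    · rw [add_right_comm]
      congr 1
      · congr 1
        refine Finset.sum_congr rfl fun i _ => Finset.sum_congr rfl fun j _ => by ring
      · refine Finset.sum_congr rfl fun i _ => Finset.sum_congr rfl fun j _ => by ring
    · refine Finset.sum_congr rfl fun i _ => Finset.sum_congr rfl fun j _ => by ring
  have hz := hP.two_mul_aeval x (fun i => (v i : ℂ) + t * x i)
  rw [← hH, hexp] at hz
  have h0 : (D : ℂ) + 2 * B * t + A * t ^ 2 = 0 := by
    have hA' : (A : ℂ) ≠ 0 := by exact_mod_cast hA.ne'
    rw [ht]
    field_simp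
    linear_combination (s : ℂ) ^ 2 * Complex.I_sq - hs2
  rw [h0] at hz
  refine hS (fun i => (v i : ℂ) + t * x i) (fun i => ?_)
    ((mul_eq_zero.1 hz).resolve_left two_ne_zero)
  have : 0 < s / A * x i := mul_pos (div_pos hs hA) (hx i)
  simpa [t] using this

/-- The graph of nonvanishing mixed second derivatives of a polynomial of degree at least `2` with
M-convex support is connected. -/
theorem IsMConvex.eq_of_pderiv {σ : Type*} {P : MvPolynomial σ ℝ} {d : ℕ}
    (hJ : IsMConvex (P.support : Set (σ →₀ ℕ))) (hP : P.IsHomogeneous (d + 2)) {u : σ → ℝ}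
    (hu : ∀ i j, pderiv i (pderiv j P) ≠ 0 → u i = u j) {i j : σ}
    (hi : pderiv i P ≠ 0) (hj : pderiv j P ≠ 0) : u i = u j := by
  classical
  have hmon : ∀ m ∈ P.support, ∀ a b, m a ≠ 0 → m b ≠ 0 → u a = u b := fun m hm a b ha hb => by
    by_cases hab : a = b
    · rw [hab]
    · exact hu a b (pderiv_pderiv_ne_zero hab hm ha hb)
  obtain ⟨α, hα, hαi⟩ := pderiv_ne_zero_iff.1 hi
  obtain ⟨β, hβ, hβj⟩ := pderiv_ne_zero_iff.1 hj
  rcases le_or_gt (α i) (β i) with hle | hlt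
  · exact hmon β hβ i j (by omega) hβj
  -- The path is `i – k – l – j`, with edges supplied by `α`, by the exchanged monomial `α - eᵢ +
  -- eₗ`, and by `β`. Degree at least two leaves some `k` in `α - eᵢ`.
  obtain ⟨l, hl, hγ, -⟩ := hJ α hα β hβ i hlt
  obtain ⟨k, hk⟩ : ∃ k, (α - Finsupp.single i 1 : σ →₀ ℕ) k ≠ 0 := by
    by_contra! h0
    have hα' : α = Finsupp.single i 1 := by
      rw [← tsub_add_cancel_of_le (Finsupp.single_le_iff.2 (Nat.one_le_iff_ne_zero.2 hαi)),
        show α - Finsupp.single i 1 = 0 from Finsupp.ext h0, zero_add]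
    have hdeg : α.degree = d + 2 := by
      by_contra hne; exact mem_support_iff.1 hα (hP.coeff_eq_zero hne)
    rw [hα', Finsupp.degree_single] at hdeg
    omega
  have h1 : u i = u k := hmon α hα i k hαi fun h => hk (by simp [h])
  have h2 : u k = u l := hmon _ hγ k l (by simp only [Finsupp.add_apply]; omega) (by simp)
  exact h1.trans (h2.trans (hmon β hβ l j (by omega) hβj))

/-- The Hessian of a Lorentzian polynomial at a positive point satisfies the reverse Cauchy–Schwarz
inequality. -/
theorem IsLorentzian.hessian_reverse_cauchySchwarz {σ : Type*} [Fintype σ] {d : ℕ}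
    {P : MvPolynomial σ ℝ} (hP : IsLorentzian (d + 2) P) {x : σ → ℝ} (hx : ∀ i, 0 < x i)
    (v : σ → ℝ) :
    (x ⬝ᵥ P.hessian x *ᵥ x) * (v ⬝ᵥ P.hessian x *ᵥ v) ≤ (x ⬝ᵥ P.hessian x *ᵥ v) ^ 2 := by
  induction d generalizing P v with
  | zero =>
    exact reverse_cauchySchwarz_of_isRealStable hP.1 hP.2.2 hx
      (hP.self_dotProduct_hessian_nonneg hx) v
  | succ d ih =>
    have hh : P.IsHomogeneous (d + 3) := hP.isHomogeneous
    refine (hessian_isSymm P x).reverse_cauchySchwarz (hP.self_dotProduct_hessian_nonneg hx)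
      (fun v hv => ?_) v
    set H := P.hessian x with hH
    have hc1 := fun i => coeff_pderiv_nonneg hP.coeff_nonneg i
    have hc2 := fun i j => coeff_pderiv_nonneg (hc1 j) i
    have hHx : ∀ i, ∑ j, H i j * x j = (d + 2) * eval x (MvPolynomial.pderiv i P) := fun i => by
      have := hh.hessian_mulVec_self x i
      simp only [mulVec, dotProduct] at this
      rw [← hH] at this
      rw [this]
      simp
    have hH0 : ∀ i j, 0 ≤ H i j := fun i j => eval_nonneg_of_coeff_nonneg (hc2 i j) hx
    have hHs : ∀ i j, H i j = H j i := fun i j => ((hessian_isSymm P x).apply i j).symm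
    have hact : ∀ i, eval x (MvPolynomial.pderiv i P) ≠ 0 ↔ MvPolynomial.pderiv i P ≠ 0 := fun i =>
      ⟨fun h h' => h (by simp [h']), fun h => (eval_pos_of_coeff_nonneg (hc1 i) h hx).ne'⟩
    -- Rescaling by `x` turns the vector `x` into the constant vector, so the row sums are multiples
    -- of `x i * ∂ᵢP(x)`.
    let G : σ → σ → ℝ := fun i j => x i * H i j * x j
    have hg : ∀ i, ∑ j, G i j = x i * ((d + 2) * eval x (MvPolynomial.pderiv i P)) := fun i => by
      rw [← hHx, Finset.mul_sum]
      exact Finset.sum_congr rfl fun j _ => by simp only [G]; ring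
    have hGu : ∀ (u : σ → ℝ) i, ∑ j, G i j * u j = x i * (H *ᵥ fun j => x j * u j) i := fun u i => by
      rw [mulVec, dotProduct, Finset.mul_sum]
      exact Finset.sum_congr rfl fun j _ => by simp only [G]; ring
    have hquad : ∀ u : σ → ℝ, ∑ i, u i * ∑ j, G i j * u j
        = (fun j => x j * u j) ⬝ᵥ H *ᵥ fun j => x j * u j := fun u => by
      refine Finset.sum_congr rfl fun i _ => ?_
      rw [hGu]; ring
    have hd2 : (0 : ℝ) < (d : ℝ) + 2 := by positivity
    have hd1 : (0 : ℝ) < (d : ℝ) + 1 := by positivity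
    -- By Euler, `(d + 1) H` is the sum of `x i` times the Hessian of `∂ᵢP`. The induction
    -- hypothesis for `∂ᵢP` bounds each summand by `(G u)ᵢ² / gᵢ`, up to the factor `d + 1`.
    have hle : ∀ u : σ → ℝ, ∑ i, u i * ∑ j, G i j * u j
        ≤ ∑ i, (∑ j, G i j * u j) ^ 2 / ∑ j, G i j := by
      intro u
      set w : σ → ℝ := fun j => x j * u j with hw
      have hsum : (d + 1) * (w ⬝ᵥ H *ᵥ w)
          = ∑ i, x i * (w ⬝ᵥ (MvPolynomial.pderiv i P).hessian x *ᵥ w) := by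
        have hE : ∀ a b, ((d : ℝ) + 1) * H a b = ∑ i, x i * (MvPolynomial.pderiv i P).hessian x a b := by
          intro a b
          have := ((hh.pderiv (i := b)).pderiv (i := a)).sum_mul_eval_pderiv x
          simp only [show d + 3 - 1 - 1 = d + 1 by omega] at this
          push_cast at this
          rw [hH, hessian, Matrix.of_apply, ← this]
          refine Finset.sum_congr rfl fun i _ => ?_
          rw [hessian, Matrix.of_apply, pderiv_pderiv_comm i a, pderiv_pderiv_comm i b]
        simp only [dotProduct, mulVec, Finset.mul_sum]
        rw [Finset.sum_comm (s := Finset.univ (α := σ))]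
        conv_rhs => rw [Finset.sum_comm]
        conv_lhs => rw [Finset.sum_comm]
        refine Finset.sum_congr rfl fun a _ => ?_
        conv_rhs => rw [Finset.sum_comm]
        refine Finset.sum_congr rfl fun b _ => ?_
        calc (d + 1) * (w a * (H a b * w b)) = ((d + 1) * H a b) * (w a * w b) := by ring
          _ = _ := by
            rw [hE, Finset.sum_mul]
            exact Finset.sum_congr rfl fun i _ => by ring
      rw [hquad, ← hw]
      refine le_of_mul_le_mul_left ?_ hd1
      rw [hsum, Finset.mul_sum]
      refine Finset.sum_le_sum fun i _ => ?_
      rw [hGu, hg, ← hw]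
      by_cases hi : MvPolynomial.pderiv i P = 0
      · have : (0 : MvPolynomial σ ℝ).hessian x = 0 := by ext; simp [hessian]
        simp [hi, this]
      have hpos := eval_pos_of_coeff_nonneg (hc1 i) hi hx
      have hL : IsLorentzian (d + 2) (MvPolynomial.pderiv i P) := hP.pderiv i
      have h1 := ih hL w
      have hdi : (MvPolynomial.pderiv i P).IsHomogeneous (d + 2) := hL.isHomogeneous
      rw [hdi.self_dotProduct_hessian_mulVec, hdi.self_dotProduct_hessian_mulVec,
        hdi.sum_mul_eval_pderiv] at h1
      have h2 : ∑ j, w j * eval x (MvPolynomial.pderiv j (MvPolynomial.pderiv i P)) = (H *ᵥ w) i := by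
        refine Finset.sum_congr rfl fun j _ => ?_
        show _ = eval x (MvPolynomial.pderiv i (MvPolynomial.pderiv j P)) * w j
        rw [pderiv_pderiv_comm i j, mul_comm]
      rw [h2] at h1
      simp only [show d + 2 - 1 = d + 1 by omega] at h1
      push_cast at h1
      have hxi := hx i
      set q := w ⬝ᵥ (MvPolynomial.pderiv i P).hessian x *ᵥ w
      set E := eval x (MvPolynomial.pderiv i P)
      set S := (H *ᵥ w) i
      have h3 : (d + 2) * E * q ≤ (d + 1) * S ^ 2 := by
        refine le_of_mul_le_mul_left ?_ hd1
        calc ((d : ℝ) + 1) * ((d + 2) * E * q) = (d + 1) * ((d + 2) * E) * q := by ring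
          _ ≤ ((d + 1) * S) ^ 2 := h1
          _ = _ := by ring
      have h4 : q ≤ (d + 1) * S ^ 2 / ((d + 2) * E) := by
        rw [le_div_iff₀ (by positivity)]; linarith
      calc x i * q ≤ x i * ((d + 1) * S ^ 2 / ((d + 2) * E)) := mul_le_mul_of_nonneg_left h4 hxi.le
        _ = _ := by field_simp
    have hfin := quadratic_form_nonpos_of_le_sum_sq_div (G := G)
      (fun i j => by simp only [G]; rw [← hHs i j]; ring)
      (fun i j => mul_nonneg (mul_nonneg (hx i).le (hH0 i j)) (hx j).le)
      (fun u hu i j hi hj => by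
        have hne : ∀ i, ∑ k, G i k ≠ 0 → MvPolynomial.pderiv i P ≠ 0 := fun i hi => by
          rw [hg] at hi
          exact (hact i).1 (right_ne_zero_of_mul (right_ne_zero_of_mul hi))
        refine IsMConvex.eq_of_pderiv (d := d + 1) hP.2.1 hh (fun a b hab => hu a b ?_)
          (hne i hi) (hne j hj)
        exact mul_ne_zero (mul_ne_zero (hx a).ne'
          (eval_pos_of_coeff_nonneg (hc2 a b) hab hx).ne') (hx b).ne')
      hle (fun j => v j / x j) (by
        rw [hh.self_dotProduct_hessian_mulVec] at hv
        have hv' := (mul_eq_zero.1 hv).resolve_left (by simp [hd2.ne'])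
        calc _ = (d + 2) * ∑ i, v i * eval x (MvPolynomial.pderiv i P) := by
              rw [Finset.mul_sum]
              refine Finset.sum_congr rfl fun i _ => ?_
              rw [hg]
              have := (hx i).ne'
              field_simp
          _ = 0 := by rw [hv', mul_zero])
    rw [hquad] at hfin
    have : (fun j => x j * (v j / x j)) = v := funext fun j => mul_div_cancel₀ _ (hx j).ne'
    rwa [this] at hfin

/-! ### Elimination of variables -/

/-- Reverse Cauchy–Schwarz with the vectors `x` and `eᵢ`. The slack `e ≤ d` lets the same `d` serve
after the degree has dropped. -/
theorem IsLorentzian.logConcave {σ : Type*} [Fintype σ] {d e : ℕ} {P : MvPolynomial σ ℝ}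
    (hP : IsLorentzian e P) (hed : e ≤ d) {x : σ → ℝ} (hx : ∀ i, 0 < x i) (i : σ) :
    (d : ℝ) * (eval x P * eval x (MvPolynomial.pderiv i (MvPolynomial.pderiv i P)))
      ≤ ((d - 1 : ℕ) : ℝ) * eval x (MvPolynomial.pderiv i P) ^ 2 := by
  classical
  have hh := hP.isHomogeneous
  rcases lt_or_ge e 2 with he | he
  · have : MvPolynomial.pderiv i (MvPolynomial.pderiv i P) = 0 :=
      hh.iterate_pderiv_eq_zero i he
    rw [this, map_zero, mul_zero, mul_zero]
    positivity
  obtain ⟨e, rfl⟩ := Nat.exists_eq_add_of_le' he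
  obtain ⟨k, rfl⟩ := Nat.exists_eq_add_of_le hed
  have h1 := hP.hessian_reverse_cauchySchwarz hx (Pi.single i 1)
  rw [hh.self_dotProduct_hessian_mulVec, hh.self_dotProduct_hessian_mulVec,
    hh.sum_mul_eval_pderiv] at h1
  simp only [Pi.single_apply, ite_mul, one_mul, zero_mul, Finset.sum_ite_eq', Finset.mem_univ,
    if_true, single_one_dotProduct, mulVec_single_one, Matrix.col_apply, hessian,
    Matrix.of_apply, show e + 2 - 1 = e + 1 by omega] at h1
  rw [show e + 2 + k - 1 = e + 1 + k by omega]
  push_cast at h1 ⊢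
  set q0 := eval x P
  set q1 := eval x (MvPolynomial.pderiv i P)
  set q2 := eval x (MvPolynomial.pderiv i (MvPolynomial.pderiv i P))
  have he1 : (0 : ℝ) < (e : ℝ) + 1 := by positivity
  have h2 : ((e : ℝ) + 2) * (q0 * q2) ≤ (e + 1) * q1 ^ 2 := by
    refine le_of_mul_le_mul_left ?_ he1
    linarith
  -- Adding `k` times this inequality passes from the true degree to the larger `d`.
  have h3 : (0 : ℝ) ≤ q1 ^ 2 - q0 * q2 := by
    have h0 : 0 ≤ q1 ^ 2 := sq_nonneg _
    nlinarith
  have hk : (0 : ℝ) ≤ k := by positivity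
  nlinarith [mul_nonneg hk h3]

/-- The coefficient bound in a single variable. -/
theorem IsLorentzian.binomialMode_mul_le {σ : Type*} [Fintype σ] [DecidableEq σ] {d e m : ℕ}
    {P : MvPolynomial σ ℝ}
    (hP : IsLorentzian e P) (hed : e ≤ d) {x : σ → ℝ} (hx : ∀ i, 0 < x i) (i : σ) {c : ℝ}
    (hc : 0 ≤ c) (h : ∀ t : ℝ, 0 < t → c * t ^ m ≤ eval (x + Pi.single i t) P) :
    binomialMode d m * c ≤ eval x ((MvPolynomial.pderiv i)^[m] P) / (m.factorial : ℝ) := by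
  refine binomialMode_mul_le_of_logConcave
    (q := fun k => eval x ((MvPolynomial.pderiv i)^[k] P))
    (fun k => eval_nonneg_of_coeff_nonneg (hP.iterate_pderiv i k).coeff_nonneg hx)
    (fun k hk => ?_) (fun k _ => ?_) hc fun t ht => ?_
  · have : (MvPolynomial.pderiv i)^[k] P = 0 := by
      by_contra h0
      exact (eval_pos_of_coeff_nonneg (hP.iterate_pderiv i k).coeff_nonneg h0 hx).ne' hk
    simp only [Function.iterate_succ_apply', this, map_zero]
  · have := (hP.iterate_pderiv i k).logConcave (Nat.sub_le_sub_right hed k) hx i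
    simpa only [Function.iterate_succ_apply'] using this
  · rw [← hP.isHomogeneous.eval_add_single hed]
    exact h t ht

/-- Extraction of a coefficient one variable at a time: the variables outside `T` have been
eliminated already. -/
theorem IsLorentzian.prod_binomialMode_mul_le_coeff {σ : Type*} [Fintype σ] [DecidableEq σ]
    {d : ℕ} (r : σ →₀ ℕ) (T : Finset σ) {e : ℕ} {P : MvPolynomial σ ℝ} (hP : IsLorentzian e P)
    (hed : e ≤ d) {c : ℝ} (hc : 0 ≤ c)
    (h : ∀ x : σ → ℝ, (∀ i, 0 < x i) → c * ∏ i ∈ T, x i ^ r i ≤ eval x P) :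
    (∏ i ∈ T, binomialMode d (r i)) * c ≤ P.coeff (∑ i ∈ T, Finsupp.single i (r i)) := by
  induction T using Finset.induction_on generalizing e P c with
  | empty =>
    simp only [Finset.prod_empty, Finset.sum_empty, one_mul, mul_one] at h ⊢
    -- Eliminated variables have stayed positive parameters; all variables now tend to zero
    -- together, leaving the constant term.
    have hcont : Continuous fun t : ℝ => eval (fun _ => t) P :=
      (MvPolynomial.continuous_eval P).comp (continuous_pi fun _ => continuous_id)
    have := ge_of_tendsto (hcont.continuousWithinAt (s := Set.Ioi 0) (x := 0))
      (Filter.eventually_of_mem self_mem_nhdsWithin fun t ht => h (fun _ => t) fun _ => ht)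
    rwa [← constantCoeff_eq, ← MvPolynomial.eval_zero]
  | insert i T hi ih =>
    -- The factor `(r i)!` offsets the one that differentiation puts on the coefficient.
    have hstep := ih (P := (MvPolynomial.pderiv i)^[r i] P)
      (c := binomialMode d (r i) * c * ((r i).factorial : ℝ)) (hP.iterate_pderiv i (r i))
      ((Nat.sub_le _ _).trans hed)
      (mul_nonneg (mul_nonneg (binomialMode_nonneg _ _) hc) (by positivity)) (fun x hx => by
        have hprod : 0 ≤ ∏ j ∈ T, x j ^ r j := Finset.prod_nonneg fun j _ => pow_nonneg (hx j).le _
        have hx' : ∀ t : ℝ, 0 < t → c * (∏ j ∈ T, x j ^ r j) * t ^ r i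
            ≤ eval (x + Pi.single i t) P := by
          intro t ht
          have hpos : ∀ j, 0 < (x + Pi.single i t : σ → ℝ) j := fun j => by
            by_cases hj : j = i
            · subst hj; simpa using add_pos (hx j) ht
            · simpa [hj] using hx j
          have hT : ∏ j ∈ T, (x + Pi.single i t : σ → ℝ) j ^ r j = ∏ j ∈ T, x j ^ r j := by
            refine Finset.prod_congr rfl fun j hj => ?_
            have : j ≠ i := fun hji => hi (hji ▸ hj)
            simp [this]
          have hxt := h (x + Pi.single i t) hpos
          rw [Finset.prod_insert hi, hT, Pi.add_apply, Pi.single_eq_same] at hxt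
          -- The bound holds at coordinate `x i + t`, and discarding `x i` leaves the pure power `t
          -- ^ r i` required by the univariate bound.
          have hpow : t ^ r i ≤ (x i + t) ^ r i :=
            pow_le_pow_left₀ ht.le (le_add_of_nonneg_left (hx i).le) _
          have := mul_le_mul_of_nonneg_left hpow (mul_nonneg hc hprod)
          linarith
        have h1 := hP.binomialMode_mul_le hed hx i (mul_nonneg hc hprod) hx'
        rw [le_div_iff₀ (by positivity)] at h1
        calc _ = binomialMode d (r i) * (c * ∏ j ∈ T, x j ^ r j) * ((r i).factorial : ℝ) := by ring
          _ ≤ _ := h1)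
    have hz : (∑ j ∈ T, Finsupp.single j (r j)) i = 0 := by
      rw [Finsupp.finsetSum_apply]
      refine Finset.sum_eq_zero fun j hj => ?_
      have : j ≠ i := fun hji => hi (hji ▸ hj)
      simp [this]
    rw [MvPolynomial.coeff_iterate_pderiv P i (r i) hz] at hstep
    rw [Finset.prod_insert hi, Finset.sum_insert hi, add_comm (Finsupp.single i (r i))]
    refine le_of_mul_le_mul_right (hstep.trans' (le_of_eq ?_))
      (show (0 : ℝ) < ((r i).factorial : ℝ) by positivity)
    ring

/-! ### Capacity and the conclusion -/

theorem capacity_nonneg_of_coeff_nonneg {σ : Type*} [Fintype σ] {P : MvPolynomial σ ℝ}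
    (hP : ∀ m, 0 ≤ P.coeff m) (α : σ → ℝ) : 0 ≤ capacity α P :=
  Real.iInf_nonneg fun x => div_nonneg (eval_nonneg_of_coeff_nonneg hP x.2)
    (Finset.prod_nonneg fun i _ => Real.rpow_nonneg (x.2 i).le _)

theorem capacity_mul_prod_le_eval {σ : Type*} [Fintype σ] {P : MvPolynomial σ ℝ}
    (hP : ∀ m, 0 ≤ P.coeff m) (α : σ → ℝ) {x : σ → ℝ} (hx : ∀ i, 0 < x i) :
    capacity α P * ∏ i, x i ^ α i ≤ eval x P := by
  rw [← le_div_iff₀ (Finset.prod_pos fun i _ => Real.rpow_pos_of_pos (hx i) _)]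
  refine ciInf_le (f := fun x : {x : σ → ℝ // ∀ i, 0 < x i} =>
    eval x.1 P / ∏ i, x.1 i ^ α i) ⟨0, ?_⟩ ⟨x, hx⟩
  rintro _ ⟨y, rfl⟩
  exact div_nonneg (eval_nonneg_of_coeff_nonneg hP y.2)
    (Finset.prod_nonneg fun i _ => Real.rpow_nonneg (y.2 i).le _)

theorem mainTheorem2 (n d : ℕ) (P : MvPolynomial (Fin n) ℝ) (hP : IsLorentzian d P)
    (r : Fin n →₀ ℕ) :
    (∏ i, (d.choose (r i) : ℝ) * ((r i : ℝ) / d) ^ r i * (((d : ℝ) - r i) / d) ^ (d - r i)) *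
      capacity (fun i => (r i : ℝ)) P ≤ P.coeff r := by
  have h := hP.prod_binomialMode_mul_le_coeff r Finset.univ le_rfl
    (capacity_nonneg_of_coeff_nonneg hP.coeff_nonneg fun i => (r i : ℝ)) fun x hx => by
      simpa only [Real.rpow_natCast] using
        capacity_mul_prod_le_eval hP.coeff_nonneg (fun i => (r i : ℝ)) hx
  rwa [Finsupp.univ_sum_single] at h
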